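/- Let $d,r\ge 1$, $A\in\mathbb{R}^{d\times d}$, $B\in\mathbb{R}^{d\times r}$ with $(A,B)$ satisfying the Kalman condition $\operatorname{rank}(B,AB,\dots,A^{d-1}B)=d$, let $Q\in\mathbb{R}^{d\times d}$ and $R\in\mathbb{R}^{r\times r}$ be symmetric positive definite, and let $x_0,x_1,\hat x\in\mathbb{R}^d$, $\hat u\in\mathbb{R}^r$. Put $\ell(x,u)=(x-\hat x)^\top Q(x-\hat x)+(u-\hat u)^\top R(u-\hat u)$ and $H(x,p,p^0,u)=\langle p,Ax+Bu\rangle+p^0\ell(x,u)$. For $T>0$ consider the problem $$\min\int_0^T \ell(\mathbf{x}(t),\mathbf{u}(t))\,dt,\qquad \dot{\mathbf{x}}=A\mathbf{x}+B\mathbf{u},\quad \mathbf{x}(0)=x_0,\ \mathbf{x}(T)=x_1,$$ over controls $\mathbf{u}\in L^2(0,T;\mathbb{R}^r)$ and the corresponding absolutely continuous trajectories. Then the static problem $\min\{\ell(x,u): Ax+Bu=0\}$ has a unique solution $(\bar x,\bar u)$, and there is a unique $\bar p\in\mathbb{R}^d$ (Lagrange multiplier, the cost multiplier being normalized to $-1/2$)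 with $\partial_xH(\bar x,\bar p,-\tfrac12,\bar u)=0$ and $\partial_uH(\bar x,\bar p,-\tfrac12,\bar u)=0$. For every $T>0$ the dynamic problem has a unique optimal solution $(\mathbf{x}_T,\mathbf{u}_T)$ (the control being unique up to null sets, and represented by a continuous function on $[0,T]$), and it has a unique adjoint vector $\mathbf{p}_T$ normalized by $p^0=-1/2$, that is, a unique absolutely continuous $\mathbf{p}_T:[0,T]\to\mathbb{R}^d$ such that, for almost every $t\in[0,T]$, $\dot{\mathbf{p}}_T(t)=-\partial_xH(\mathbf{x}_T(t),\mathbf{p}_T(t),-\tfrac12,\mathbf{u}_T(t))$ and $\mathbf{u}_T(t)$ maximizes $v\mapsto H(\mathbf{x}_T(t),\mathbf{p}_T(t),-\tfrac12,v)$ over $\mathbb{R}^r$. Moreover, there is $\nu>0$ such that for every $T_0>0$ there is $C>0$ such that, for all $T\ge T_0$ and all $t\in[0,T]$, $$\|\mathbf{x}_T(t)-\bar x\|+\|\mathbf{u}_T(t)-\bar u\|+\|\mathbf{p}_T(t)-\bar p\|\le C\left(e^{-\nu t}+e^{-\nu(T-t)}\right).$$ Here $\nu$ and $C$ do not depend on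 $T$, and $\nu$ does not depend on $T_0$. -/

import Mathlib

open Set MeasureTheory

/-- The data of a linear-quadratic optimal control problem with state space `ℝ^d`, control space
`ℝ^r` and fixed endpoints. -/
structure LQProblem (d r : ℕ) where
  A : Matrix (Fin d) (Fin d) ℝ
  B : Matrix (Fin d) (Fin r) ℝ
  Q : Matrix (Fin d) (Fin d) ℝ
  R : Matrix (Fin r) (Fin r) ℝ
  /-- initial state -/
  x₀ : EuclideanSpace ℝ (Fin d)
  /-- final state -/
  x₁ : EuclideanSpace ℝ (Fin d)
  /-- target state in the cost -/
  xhat : EuclideanSpace ℝ (Fin d)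
  /-- target control in the cost -/
  uhat : EuclideanSpace ℝ (Fin r)

/-- The Kalman matrix `(B, AB, …, A^{d-1}B)`. -/
def kalmanMatrix {d r : ℕ} (A : Matrix (Fin d) (Fin d) ℝ) (B : Matrix (Fin d) (Fin r) ℝ) :
    Matrix (Fin d) (Fin d × Fin r) ℝ :=
  Matrix.of fun i kj => (A ^ (kj.1 : ℕ) * B) i kj.2

/-- The Kalman rank condition `rank (B, AB, …, A^{d-1}B) = d`. -/
def KalmanCondition {d r : ℕ} (A : Matrix (Fin d) (Fin d) ℝ) (B : Matrix (Fin d) (Fin r) ℝ) :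
    Prop :=
  (kalmanMatrix A B).rank = d

namespace LQProblem

noncomputable section

/-- The dynamics `A x + B u`. -/
def dynamics {d r : ℕ} (P : LQProblem d r) (x : EuclideanSpace ℝ (Fin d))
    (u : EuclideanSpace ℝ (Fin r)) : EuclideanSpace ℝ (Fin d) :=
  Matrix.toEuclideanLin P.A x + Matrix.toEuclideanLin P.B u

/-- The running cost `(x - x̂)ᵀ Q (x - x̂) + (u - û)ᵀ R (u - û)`. -/
def runningCost {d r : ℕ} (P : LQProblem d r) (x : EuclideanSpace ℝ (Fin d))
    (u : EuclideanSpace ℝ (Fin r)) : ℝ :=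
  inner ℝ (x - P.xhat) (Matrix.toEuclideanLin P.Q (x - P.xhat)) +
    inner ℝ (u - P.uhat) (Matrix.toEuclideanLin P.R (u - P.uhat))

/-- The Hamiltonian `H(x, p, p⁰, u) = ⟨p, A x + B u⟩ + p⁰ ℓ(x, u)`, `ℓ` the running cost. -/
def hamiltonian {d r : ℕ} (P : LQProblem d r) (x p : EuclideanSpace ℝ (Fin d)) (p0 : ℝ)
    (u : EuclideanSpace ℝ (Fin r)) : ℝ :=
  inner ℝ p (P.dynamics x u) + p0 * P.runningCost x u

/-- `(x, u)` is admissible on `[0, T]`: the control is square integrable, and `x` is the (absolutely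
continuous) solution of `x' = A x + B u` a.e. with `x 0 = x₀`, written as an integral equation,
which reaches `x₁` at time `T`. Values outside `[0, T]` are irrelevant. -/
structure IsAdmissible {d r : ℕ} (P : LQProblem d r) (T : ℝ)
    (x : ℝ → EuclideanSpace ℝ (Fin d)) (u : ℝ → EuclideanSpace ℝ (Fin r)) : Prop where
  memLp_control : MemLp u 2 (volume.restrict (Icc 0 T))
  continuousOn_state : ContinuousOn x (Icc 0 T)
  state_eq : ∀ t ∈ Icc 0 T, x t = P.x₀ + ∫ s in (0 : ℝ)..t, P.dynamics (x s) (u s)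
  final_eq : x T = P.x₁

/-- The cost of a state-control pair on `[0, T]`. -/
def cost {d r : ℕ} (P : LQProblem d r) (T : ℝ)
    (x : ℝ → EuclideanSpace ℝ (Fin d)) (u : ℝ → EuclideanSpace ℝ (Fin r)) : ℝ :=
  ∫ t in (0 : ℝ)..T, P.runningCost (x t) (u t)

/-- `(x, u)` is an optimal solution of the control problem on `[0, T]`. -/
def IsOptimal {d r : ℕ} (P : LQProblem d r) (T : ℝ)
    (x : ℝ → EuclideanSpace ℝ (Fin d)) (u : ℝ → EuclideanSpace ℝ (Fin r)) : Prop :=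
  P.IsAdmissible T x u ∧ ∀ x' u', P.IsAdmissible T x' u' → P.cost T x u ≤ P.cost T x' u'

/-- `p` is an adjoint vector of the pair `(x, u)` on `[0, T]` in the sense of the Pontryagin maximum
principle, normalized by `p⁰ = -1/2`: it is an absolutely continuous solution of `p' = -∂H/∂x` a.e.
(written as an integral equation), and the control maximizes the Hamiltonian a.e. -/
structure IsNormalAdjoint {d r : ℕ} (P : LQProblem d r) (T : ℝ)
    (x : ℝ → EuclideanSpace ℝ (Fin d)) (u : ℝ → EuclideanSpace ℝ (Fin r))
    (p : ℝ → EuclideanSpace ℝ (Fin d)) : Prop where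
  continuousOn_adjoint : ContinuousOn p (Icc 0 T)
  adjoint_eq : ∀ t ∈ Icc 0 T, p t = p 0 +
    ∫ s in (0 : ℝ)..t, -gradient (fun ξ => P.hamiltonian ξ (p s) (-1 / 2) (u s)) (x s)
  maximum_condition : ∀ᵐ t ∂(volume.restrict (Icc 0 T)), ∀ v,
    P.hamiltonian (x t) (p t) (-1 / 2) v ≤ P.hamiltonian (x t) (p t) (-1 / 2) (u t)

/-- `(xbar, ubar)` minimizes the running cost among the equilibria `A x + B u = 0`. -/
def IsStaticOptimum {d r : ℕ} (P : LQProblem d r) (xbar : EuclideanSpace ℝ (Fin d))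
    (ubar : EuclideanSpace ℝ (Fin r)) : Prop :=
  P.dynamics xbar ubar = 0 ∧
    ∀ x u, P.dynamics x u = 0 → P.runningCost xbar ubar ≤ P.runningCost x u

/-- `pbar` is a normal Lagrange multiplier, with cost multiplier `-1/2`, of the static problem
at `(xbar, ubar)`: the Lagrangian `⟨pbar, A x + B u⟩ - ℓ(x, u) / 2` is stationary there. -/
def IsStaticMultiplier {d r : ℕ} (P : LQProblem d r) (xbar : EuclideanSpace ℝ (Fin d))
    (ubar : EuclideanSpace ℝ (Fin r)) (pbar : EuclideanSpace ℝ (Fin d)) : Prop :=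
  gradient (fun x => P.hamiltonian x pbar (-1 / 2) ubar) xbar = 0 ∧
    gradient (fun u => P.hamiltonian xbar pbar (-1 / 2) u) ubar = 0

end

end LQProblem

/-! Subtracting the static solution from an extremal leaves `(y, q) = (x - xbar, p - pbar)`, which
solves the linear Hamiltonian system with `N = B R⁻¹ Bᵀ`. Everything rests on the pairing `g = ⟨q,
y⟩`, whose derivative `⟨y, Q y⟩ + ⟨q, N q⟩` is nonnegative. By the Kalman condition `g` increases
strictly on every interval along a nonzero solution (`HamiltonianHyp.pairing_lt`), and by
compactness its increment over a fixed time bounds a multiple of the squared norm at both ends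
(`HamiltonianHyp.exists_pairing_increment`).

This replaces any Riccati equation or spectral splitting. Since `|g| ≤ ‖z‖²`, both `g` and its
negated time reversal grow geometrically, which gives the dichotomy
`HamiltonianHyp.exists_dichotomy`. The same increment bounds the boundary values of `q` by those of
`y`, uniformly for `T ≥ T₀`. Strict increase makes the boundary value map and the static system
injective, hence solvable in finite dimension.

An extremal is the unique optimum because the cost of a competitor exceeds its cost by exactly a
positive definite second variation (`LQProblem.IsExtremal.cost_eq`). The adjoint vector is unique
because the difference of two candidates is unobserved. -/

/-! ### The flow of a linear differential equation. -/

section LinearFlow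

variable {V : Type*} [NormedAddCommGroup V] [NormedSpace ℝ V] [CompleteSpace V]

/-- The flow `t ↦ exp (t M)` of the linear differential equation `z' = M z`. -/
noncomputable def linearFlow (M : V →L[ℝ] V) (t : ℝ) : V →L[ℝ] V := NormedSpace.exp (t • M)

omit [CompleteSpace V] in
theorem linearFlow_zero (M : V →L[ℝ] V) (z : V) : linearFlow M 0 z = z := by
  simp [linearFlow]

theorem linearFlow_add (M : V →L[ℝ] V) (s t : ℝ) :
    linearFlow M (s + t) = linearFlow M s * linearFlow M t := by
  let _ : NormedAlgebra ℚ (V →L[ℝ] V) := NormedAlgebra.restrictScalars ℚ ℝ (V →L[ℝ] V)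
  rw [linearFlow, add_smul, NormedSpace.exp_add_of_commute]
  · rfl
  · exact ((Commute.refl M).smul_left s).smul_right t

theorem linearFlow_add_apply (M : V →L[ℝ] V) (s t : ℝ) (z : V) :
    linearFlow M (s + t) z = linearFlow M s (linearFlow M t z) := by
  rw [linearFlow_add]; rfl

theorem linearFlow_neg_apply (M : V →L[ℝ] V) (t : ℝ) (z : V) :
    linearFlow M (-t) (linearFlow M t z) = z := by
  rw [← linearFlow_add_apply]; simp [linearFlow_zero]

theorem hasDerivAt_linearFlow_apply (M : V →L[ℝ] V) (z : V) (t : ℝ) :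
    HasDerivAt (fun s => linearFlow M s z) (M (linearFlow M t z)) t := by
  have h := (hasDerivAt_exp_smul_const' (𝕂 := ℝ) M t).clm_apply (hasDerivAt_const t z)
  simpa [linearFlow] using h

/-- `M` commutes with its exponential, so the orbit of `z` has zero derivative. -/
theorem linearFlow_apply_of_map_eq_zero (M : V →L[ℝ] V) {z : V} (hz : M z = 0) (t : ℝ) :
    linearFlow M t z = z := by
  have hM : ∀ s, M (linearFlow M s z) = 0 := fun s => by
    have hcomm : Commute M (linearFlow M s) := by
      let _ : NormedAlgebra ℚ (V →L[ℝ] V) := NormedAlgebra.restrictScalars ℚ ℝ (V →L[ℝ] V)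
      exact ((Commute.refl M).smul_right s).exp_right
    have := congrArg (fun f : V →L[ℝ] V => f z) hcomm.eq
    simpa [hz] using this
  have hd : ∀ s, HasDerivAt (fun s => linearFlow M s z) 0 s := fun s => by
    simpa [hM s] using hasDerivAt_linearFlow_apply M z s
  have := is_const_of_deriv_eq_zero (fun s => (hd s).differentiableAt) (fun s => (hd s).deriv) t 0
  simpa [linearFlow_zero] using this

end LinearFlow

/-! ### Two elementary estimates: coercivity by compactness, and geometric growth. -/

theorem exists_pos_mul_sq_norm_le {V : Type*} [NormedAddCommGroup V] [NormedSpace ℝ V]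
    [FiniteDimensional ℝ V] {f : V → ℝ} (hf : Continuous f)
    (hsmul : ∀ (a : ℝ) z, f (a • z) = a ^ 2 * f z) (hpos : ∀ z, z ≠ 0 → 0 < f z) :
    ∃ c > 0, ∀ z, c * ‖z‖ ^ 2 ≤ f z := by
  have hf0 : f 0 = 0 := by simpa using hsmul 0 0
  -- The unit sphere is empty exactly when the space is trivial.
  rcases (Metric.sphere (0 : V) 1).eq_empty_or_nonempty with he | hne
  · refine ⟨1, one_pos, fun z => ?_⟩
    have hz : z = 0 := by
      by_contra h
      have : ‖z‖⁻¹ • z ∈ Metric.sphere (0 : V) 1 := by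
        simp [norm_smul, inv_mul_cancel₀ (norm_ne_zero_iff.2 h)]
      simp [he] at this
    simp [hz, hf0]
  · obtain ⟨w, hw, hmin⟩ := (isCompact_sphere (0 : V) 1).exists_isMinOn hne hf.continuousOn
    have hw1 : ‖w‖ = 1 := by simpa using hw
    refine ⟨f w, hpos w (by rintro rfl; simp at hw1), fun z => ?_⟩
    by_cases h : z = 0
    · simp [h, hf0]
    · have hz := norm_ne_zero_iff.2 h
      have hmem : ‖z‖⁻¹ • z ∈ Metric.sphere (0 : V) 1 := by
        simp [norm_smul, inv_mul_cancel₀ hz]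
      have h1 : f w ≤ f (‖z‖⁻¹ • z) := hmin hmem
      rw [hsmul, inv_pow] at h1
      have h2 : 0 < ‖z‖ ^ 2 := by positivity
      calc f w * ‖z‖ ^ 2 ≤ ((‖z‖ ^ 2)⁻¹ * f z) * ‖z‖ ^ 2 := by gcongr
        _ = f z := by field_simp

/-- A monotone function growing by a factor `1 + c` over unit time decays exponentially
backwards in time. -/
theorem Monotone.le_exp_mul_abs {f : ℝ → ℝ} (hf : Monotone f) {c : ℝ} (hc : 0 < c)
    (hgrow : ∀ t, (1 + c) * f t ≤ f (t + 1)) {t T : ℝ} (htT : t ≤ T) :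
    f t ≤ (1 + c) * Real.exp (-Real.log (1 + c) * (T - t)) * |f T| := by
  have h1 : (0 : ℝ) < 1 + c := by linarith
  have hpow : ∀ n : ℕ, (1 + c) ^ n * f t ≤ f (t + n) := by
    intro n
    induction n with
    | zero => simp
    | succ n ih =>
      calc (1 + c) ^ (n + 1) * f t = (1 + c) * ((1 + c) ^ n * f t) := by ring
        _ ≤ (1 + c) * f (t + n) := by gcongr
        _ ≤ f (t + n + 1) := hgrow _
        _ = f (t + (n + 1 : ℕ)) := by push_cast; ring_nf
  -- Growth is iterated over whole time units; the prefactor `1 + c` absorbs the remaining fraction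
  -- of a unit.
  set n := ⌊T - t⌋₊
  have hn1 : (n : ℝ) ≤ T - t := Nat.floor_le (by linarith)
  have hn2 : T - t < n + 1 := Nat.lt_floor_add_one _
  have h2 : (1 + c) ^ n * f t ≤ |f T| :=
    (hpow n).trans ((hf (by linarith)).trans (le_abs_self _))
  have hlog : 0 < Real.log (1 + c) := Real.log_pos (by linarith)
  have h3 : 1 ≤ (1 + c) * Real.exp (-Real.log (1 + c) * (T - t)) * (1 + c) ^ n := by
    have : (1 + c) * Real.exp (-Real.log (1 + c) * (T - t)) * (1 + c) ^ n
        = Real.exp (Real.log (1 + c) * (n + 1 - (T - t))) := by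
      rw [show Real.log (1 + c) * (n + 1 - (T - t)) = Real.log (1 + c) +
        -Real.log (1 + c) * (T - t) + n * Real.log (1 + c) by ring, Real.exp_add, Real.exp_add,
        Real.exp_log h1, Real.exp_nat_mul, Real.exp_log h1]
    rw [this]
    exact Real.one_le_exp (mul_nonneg hlog.le (by linarith))
  set k := (1 + c) * Real.exp (-Real.log (1 + c) * (T - t))
  have hk : 0 < k := by positivity
  rcases le_or_gt (f t) 0 with h | h
  · exact h.trans (by positivity)
  · calc f t ≤ (k * (1 + c) ^ n) * f t := le_mul_of_one_le_left h.le h3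
      _ = k * ((1 + c) ^ n * f t) := by ring
      _ ≤ k * |f T| := by gcongr

/-! ### The linear Hamiltonian system: dichotomy and boundary value problem. -/

section Hamiltonian

open ContinuousLinearMap

variable {E F : Type*} [NormedAddCommGroup E] [InnerProductSpace ℝ E] [CompleteSpace E]
  [NormedAddCommGroup F] [NormedSpace ℝ F]

/-- An adjoint trajectory which is not observed on a nonempty open interval vanishes there. -/
theorem eq_zero_of_unobserved {A : E →L[ℝ] E} {N : E →L[ℝ] F}
    (hobs : ∀ q, (∀ k : ℕ, N ((adjoint A ^ k) q) = 0) → q = 0) {q : ℝ → E} {a b : ℝ}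
    (hq : ∀ t ∈ Ioo a b, HasDerivAt q (-adjoint A (q t)) t) (hN : ∀ t ∈ Ioo a b, N (q t) = 0) :
    ∀ t ∈ Ioo a b, q t = 0 := by
  -- Each differentiation of the vanishing observation produces one more factor `-A†`.
  have key : ∀ k : ℕ, ∀ t ∈ Ioo a b, N ((adjoint A ^ k) (q t)) = 0 := by
    intro k
    induction k with
    | zero => simpa using hN
    | succ k ih =>
      intro t ht
      have h1 : HasDerivAt (fun s => N ((adjoint A ^ k) (q s)))
          (N ((adjoint A ^ k) (-adjoint A (q t)))) t :=
        (N.hasFDerivAt.comp_hasDerivAt t ((adjoint A ^ k).hasFDerivAt.comp_hasDerivAt t (hq t ht)))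
      have h2 : HasDerivAt (fun s => N ((adjoint A ^ k) (q s))) 0 t :=
        (hasDerivAt_const t (0 : F)).congr_of_eventuallyEq
          (Filter.eventually_of_mem (Ioo_mem_nhds ht.1 ht.2) ih)
      have h3 := h1.unique h2
      simpa [pow_succ] using h3
  exact fun t ht => hobs _ fun k => key k t ht

/-- The linear Hamiltonian system `y' = A y + N q`, `q' = Q y - A† q`. -/
noncomputable def hamiltonianMap (A N Q : E →L[ℝ] E) : E × E →L[ℝ] E × E :=
  (A ∘L fst ℝ E E + N ∘L snd ℝ E E).prod (Q ∘L fst ℝ E E - adjoint A ∘L snd ℝ E E)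

theorem hamiltonianMap_apply (A N Q : E →L[ℝ] E) (z : E × E) :
    hamiltonianMap A N Q z = (A z.1 + N z.2, Q z.1 - adjoint A z.2) := rfl

/-- Positivity and observability hypotheses on the linear Hamiltonian system. -/
structure HamiltonianHyp (A N Q : E →L[ℝ] E) : Prop where
  Q_pos : ∀ x, x ≠ 0 → 0 < inner ℝ x (Q x)
  N_nonneg : ∀ q, 0 ≤ inner ℝ q (N q)
  N_eq_zero : ∀ q, inner ℝ q (N q) = 0 → N q = 0
  observable : ∀ q, (∀ k : ℕ, N ((adjoint A ^ k) q) = 0) → q = 0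

variable {A N Q : E →L[ℝ] E}

theorem hasDerivAt_fst_hamiltonianFlow (A N Q : E →L[ℝ] E) (z : E × E) (t : ℝ) :
    HasDerivAt (fun s => (linearFlow (hamiltonianMap A N Q) s z).1)
      (A (linearFlow (hamiltonianMap A N Q) t z).1 +
        N (linearFlow (hamiltonianMap A N Q) t z).2) t :=
  (fst ℝ E E).hasFDerivAt.comp_hasDerivAt t (hasDerivAt_linearFlow_apply _ z t)

theorem hasDerivAt_snd_hamiltonianFlow (A N Q : E →L[ℝ] E) (z : E × E) (t : ℝ) :
    HasDerivAt (fun s => (linearFlow (hamiltonianMap A N Q) s z).2)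
      (Q (linearFlow (hamiltonianMap A N Q) t z).1 -
        adjoint A (linearFlow (hamiltonianMap A N Q) t z).2) t :=
  (snd ℝ E E).hasFDerivAt.comp_hasDerivAt t (hasDerivAt_linearFlow_apply _ z t)

/-- Along the flow, `⟨q, y⟩` increases at the rate `⟨y, Q y⟩ + ⟨q, N q⟩`. -/
theorem hasDerivAt_pairing (A N Q : E →L[ℝ] E) (z : E × E) (t : ℝ) :
    HasDerivAt (fun s => inner ℝ (linearFlow (hamiltonianMap A N Q) s z).2
        (linearFlow (hamiltonianMap A N Q) s z).1)
      (inner ℝ (linearFlow (hamiltonianMap A N Q) t z).1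
          (Q (linearFlow (hamiltonianMap A N Q) t z).1) +
        inner ℝ (linearFlow (hamiltonianMap A N Q) t z).2
          (N (linearFlow (hamiltonianMap A N Q) t z).2)) t := by
  convert! (hasDerivAt_snd_hamiltonianFlow A N Q z t).inner ℝ
    (hasDerivAt_fst_hamiltonianFlow A N Q z t) using 1
  rw [inner_add_right, inner_sub_left, adjoint_inner_left, real_inner_comm (Q _)]
  ring

theorem HamiltonianHyp.rate_nonneg (h : HamiltonianHyp A N Q) (z : E × E) :
    0 ≤ inner ℝ z.1 (Q z.1) + inner ℝ z.2 (N z.2) := by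
  refine add_nonneg ?_ (h.N_nonneg _)
  by_cases hz : z.1 = 0
  · simp [hz]
  · exact (h.Q_pos _ hz).le

theorem HamiltonianHyp.monotone_pairing (h : HamiltonianHyp A N Q) (z : E × E) :
    Monotone (fun s => inner ℝ (linearFlow (hamiltonianMap A N Q) s z).2
        (linearFlow (hamiltonianMap A N Q) s z).1) :=
  monotone_of_deriv_nonneg (fun s => (hasDerivAt_pairing A N Q z s).differentiableAt) fun s => by
    rw [(hasDerivAt_pairing A N Q z s).deriv]
    exact h.rate_nonneg _

/-- Otherwise monotonicity makes the pairing constant on `(a, b)`, so its rate vanishes there. Then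
`y = 0` and `N q = 0`, so `q` is an unobserved adjoint trajectory and vanishes too; invertibility of
the flow gives `z = 0`. -/
theorem HamiltonianHyp.pairing_lt (h : HamiltonianHyp A N Q) {z : E × E} (hz : z ≠ 0)
    {a b : ℝ} (hab : a < b) :
    inner ℝ (linearFlow (hamiltonianMap A N Q) a z).2 (linearFlow (hamiltonianMap A N Q) a z).1 <
      inner ℝ (linearFlow (hamiltonianMap A N Q) b z).2
        (linearFlow (hamiltonianMap A N Q) b z).1 := by
  by_contra hcon
  push Not at hcon
  have hmono := h.monotone_pairing z
  have hconst : ∀ t ∈ Ioo a b, inner ℝ (linearFlow (hamiltonianMap A N Q) t z).1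
          (Q (linearFlow (hamiltonianMap A N Q) t z).1) +
        inner ℝ (linearFlow (hamiltonianMap A N Q) t z).2
          (N (linearFlow (hamiltonianMap A N Q) t z).2) = 0 := by
    intro t ht
    refine (hasDerivAt_pairing A N Q z t).unique
      ((hasDerivAt_const t (inner ℝ (linearFlow (hamiltonianMap A N Q) a z).2
        (linearFlow (hamiltonianMap A N Q) a z).1)).congr_of_eventuallyEq
          (Filter.eventually_of_mem (Ioo_mem_nhds ht.1 ht.2) fun s hs => ?_))
    exact le_antisymm ((hmono hs.2.le).trans hcon) (hmono hs.1.le)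
  have hy : ∀ t ∈ Ioo a b, (linearFlow (hamiltonianMap A N Q) t z).1 = 0 := by
    intro t ht
    by_contra hne
    linarith [hconst t ht, h.Q_pos _ hne, h.N_nonneg (linearFlow (hamiltonianMap A N Q) t z).2]
  have hNq : ∀ t ∈ Ioo a b, N (linearFlow (hamiltonianMap A N Q) t z).2 = 0 := fun t ht =>
    h.N_eq_zero _ (by simpa [hy t ht] using hconst t ht)
  have hq := eq_zero_of_unobserved h.observable (fun t ht => by
    simpa [hy t ht] using hasDerivAt_snd_hamiltonianFlow A N Q z t) hNq
  obtain ⟨t, ht⟩ := nonempty_Ioo.2 hab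
  have h0 : linearFlow (hamiltonianMap A N Q) t z = 0 := Prod.ext (hy t ht) (hq t ht)
  have := linearFlow_neg_apply (hamiltonianMap A N Q) t z
  rw [h0, map_zero] at this
  exact hz this.symm

omit [CompleteSpace E] in
theorem abs_pairing_le (z : E × E) : |inner ℝ z.2 z.1| ≤ ‖z‖ ^ 2 := by
  calc |inner ℝ z.2 z.1| ≤ ‖z.2‖ * ‖z.1‖ := abs_real_inner_le_norm _ _
    _ ≤ ‖z‖ * ‖z‖ := by
      gcongr
      · exact norm_snd_le z
      · exact norm_fst_le z
    _ = ‖z‖ ^ 2 := by ring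

variable [FiniteDimensional ℝ E]

/-- The increment of the pairing is a quadratic form in the initial point, positive definite by
`pairing_lt`. -/
theorem HamiltonianHyp.exists_pairing_gap (h : HamiltonianHyp A N Q) {a b : ℝ} (hab : a < b) :
    ∃ c > 0, ∀ z, c * ‖z‖ ^ 2 ≤
      inner ℝ (linearFlow (hamiltonianMap A N Q) b z).2
        (linearFlow (hamiltonianMap A N Q) b z).1 -
      inner ℝ (linearFlow (hamiltonianMap A N Q) a z).2
        (linearFlow (hamiltonianMap A N Q) a z).1 := by
  refine exists_pos_mul_sq_norm_le (by fun_prop) (fun r z => ?_)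
    (fun z hz => sub_pos.2 (h.pairing_lt hz hab))
  simp only [map_smul, Prod.smul_fst, Prod.smul_snd, real_inner_smul_left, real_inner_smul_right]
  ring

/-- Over a time `τ`, the increase of `⟨q, y⟩` controls the squared norm at both ends. -/
theorem HamiltonianHyp.exists_pairing_increment (h : HamiltonianHyp A N Q) {τ : ℝ} (hτ : 0 < τ) :
    ∃ c > 0, ∀ z t,
      c * ‖linearFlow (hamiltonianMap A N Q) t z‖ ^ 2 ≤
        inner ℝ (linearFlow (hamiltonianMap A N Q) (t + τ) z).2
          (linearFlow (hamiltonianMap A N Q) (t + τ) z).1 -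
        inner ℝ (linearFlow (hamiltonianMap A N Q) t z).2
          (linearFlow (hamiltonianMap A N Q) t z).1 ∧
      c * ‖linearFlow (hamiltonianMap A N Q) (t + τ) z‖ ^ 2 ≤
        inner ℝ (linearFlow (hamiltonianMap A N Q) (t + τ) z).2
          (linearFlow (hamiltonianMap A N Q) (t + τ) z).1 -
        inner ℝ (linearFlow (hamiltonianMap A N Q) t z).2
          (linearFlow (hamiltonianMap A N Q) t z).1 := by
  obtain ⟨c₁, hc₁, h₁⟩ := h.exists_pairing_gap hτ
  -- The gap on `[-τ, 0]`, based at the final point, controls the norm at the right end.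
  obtain ⟨c₂, hc₂, h₂⟩ := h.exists_pairing_gap (neg_lt_zero.2 hτ)
  refine ⟨min c₁ c₂, lt_min hc₁ hc₂, fun z t => ⟨?_, ?_⟩⟩
  · have := h₁ (linearFlow (hamiltonianMap A N Q) t z)
    simp only [← linearFlow_add_apply, zero_add, add_comm τ t] at this
    exact (mul_le_mul_of_nonneg_right (min_le_left _ _) (by positivity)).trans this
  · have := h₂ (linearFlow (hamiltonianMap A N Q) (t + τ) z)
    simp only [← linearFlow_add_apply, zero_add, neg_add_cancel_comm_assoc] at this
    exact (mul_le_mul_of_nonneg_right (min_le_right _ _) (by positivity)).trans this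

/-- Exponential dichotomy of the Hamiltonian flow. -/
theorem HamiltonianHyp.exists_dichotomy (h : HamiltonianHyp A N Q) :
    ∃ ν > 0, ∃ K > 0, ∀ z T t, t ∈ Icc 0 T →
      ‖linearFlow (hamiltonianMap A N Q) t z‖ ≤
        K * (Real.exp (-ν * t) * ‖z‖ +
          Real.exp (-ν * (T - t)) * ‖linearFlow (hamiltonianMap A N Q) T z‖) := by
  obtain ⟨c, hc, hinc⟩ := h.exists_pairing_increment one_pos
  -- The pairing grows by `1 + c` per unit time but compares with squared norms, hence the half.
  set ν := Real.log (1 + c) / 2 with hνdef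
  have hν : 0 < ν := div_pos (Real.log_pos (by linarith)) two_pos
  set L := ‖linearFlow (hamiltonianMap A N Q) 1‖
  set K2 := (1 + c) / c * (1 + L ^ 2)
  have hK2 : 0 < K2 := by positivity
  refine ⟨ν, hν, Real.sqrt K2, Real.sqrt_pos.2 hK2, fun z T t ht => ?_⟩
  set g : ℝ → ℝ := fun s => inner ℝ (linearFlow (hamiltonianMap A N Q) s z).2
        (linearFlow (hamiltonianMap A N Q) s z).1 with hg
  have hgabs : ∀ s, |g s| ≤ ‖linearFlow (hamiltonianMap A N Q) s z‖ ^ 2 := fun s =>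
    abs_pairing_le _
  have hmono : Monotone g := h.monotone_pairing z
  have hgrow : ∀ s, (1 + c) * g s ≤ g (s + 1) := fun s => by
    have := (hinc z s).1
    have h2 := mul_le_mul_of_nonneg_left ((le_abs_self _).trans (hgabs s)) hc.le
    change _ ≤ g (s + 1) - g s at this
    linarith
  -- Reversing time and changing sign yields a second monotone function with the same growth; it
  -- gives the decay from the initial end.
  have hgrow' : ∀ s, (1 + c) * (-g (-s)) ≤ -g (-(s + 1)) := fun s => by
    have := (hinc z (-(s + 1))).2
    rw [show -(s + 1) + 1 = -s by ring] at this
    have h2 := mul_le_mul_of_nonneg_left ((neg_le_abs _).trans (hgabs (-s))) hc.le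
    change _ ≤ g (-s) - g (-(s + 1)) at this
    linarith
  have hmono' : Monotone (fun s => -g (-s)) := fun a b hab => neg_le_neg (hmono (neg_le_neg hab))
  -- The increment on `[t, t + 1]` may run past `T`, so the comparison is made at `T + 1`, at the
  -- price of the factor `L`.
  have hT : ‖linearFlow (hamiltonianMap A N Q) (T + 1) z‖ ≤
      L * ‖linearFlow (hamiltonianMap A N Q) T z‖ := by
    rw [add_comm, linearFlow_add_apply]
    exact le_opNorm _ _
  have hup : g (t + 1) ≤ (1 + c) * Real.exp (-ν * (T - t)) ^ 2 *
      (L * ‖linearFlow (hamiltonianMap A N Q) T z‖) ^ 2 := by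
    have := hmono.le_exp_mul_abs hc hgrow (t := t + 1) (T := T + 1) (by linarith [ht.2])
    have he : Real.exp (-Real.log (1 + c) * (T + 1 - (t + 1))) = Real.exp (-ν * (T - t)) ^ 2 := by
      rw [← Real.exp_nat_mul]; congr 1; rw [hνdef]; push_cast; ring
    rw [he] at this
    refine this.trans ?_
    gcongr
    exact (hgabs _).trans (by gcongr)
  have hlow : -g t ≤ (1 + c) * Real.exp (-ν * t) ^ 2 * ‖z‖ ^ 2 := by
    have := hmono'.le_exp_mul_abs hc hgrow' (t := -t) (T := 0) (by linarith [ht.1])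
    have he : Real.exp (-Real.log (1 + c) * (0 - -t)) = Real.exp (-ν * t) ^ 2 := by
      rw [← Real.exp_nat_mul]; congr 1; rw [hνdef]; push_cast; ring
    rw [he] at this
    simp only [neg_neg, neg_zero, abs_neg] at this
    refine this.trans ?_
    gcongr
    simpa [linearFlow_zero] using hgabs 0
  have hmain := (hinc z t).1
  change _ ≤ g (t + 1) - g t at hmain
  set X := Real.exp (-ν * t) * ‖z‖
  set Y := Real.exp (-ν * (T - t)) * ‖linearFlow (hamiltonianMap A N Q) T z‖
  have hX : 0 ≤ X := by positivity
  have hY : 0 ≤ Y := by positivity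
  have hsq : ‖linearFlow (hamiltonianMap A N Q) t z‖ ^ 2 ≤ K2 * (X + Y) ^ 2 := by
    have h1 : c * ‖linearFlow (hamiltonianMap A N Q) t z‖ ^ 2 ≤
        (1 + c) * (X ^ 2 + L ^ 2 * Y ^ 2) := by
      simp only [X, Y]; nlinarith [hup, hlow, hmain]
    have h2 : X ^ 2 + L ^ 2 * Y ^ 2 ≤ (1 + L ^ 2) * (X + Y) ^ 2 := by
      have : 0 ≤ L ^ 2 := by positivity
      nlinarith [mul_nonneg hX hY, mul_nonneg this (mul_nonneg hX hY), sq_nonneg Y,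
        mul_nonneg this (sq_nonneg X)]
    have h3 : c * ‖linearFlow (hamiltonianMap A N Q) t z‖ ^ 2 ≤
        c * (K2 * (X + Y) ^ 2) := by
      calc _ ≤ (1 + c) * ((1 + L ^ 2) * (X + Y) ^ 2) := h1.trans (by gcongr)
        _ = _ := by simp only [K2]; field_simp
    exact le_of_mul_le_mul_left h3 hc
  refine le_of_sq_le_sq ?_ (by positivity)
  rw [mul_pow, Real.sq_sqrt hK2.le]
  exact hsq

/-- The boundary values of the state control those of the adjoint, uniformly in the horizon. -/
theorem HamiltonianHyp.exists_boundary_bound (h : HamiltonianHyp A N Q) {T₀ : ℝ} (hT₀ : 0 < T₀) :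
    ∃ K > 0, ∀ z T, T₀ ≤ T →
      ‖z‖ + ‖linearFlow (hamiltonianMap A N Q) T z‖ ≤
        K * (‖z.1‖ + ‖(linearFlow (hamiltonianMap A N Q) T z).1‖) := by
  obtain ⟨c, hc, hinc⟩ := h.exists_pairing_increment hT₀
  -- One factor 2 comes from adding the two end estimates, the other from `(a + b)² ≤ 2 (a² + b²)`.
  refine ⟨4 / c, by positivity, fun z T hT => ?_⟩
  set w := linearFlow (hamiltonianMap A N Q) T z with hw
  set g : ℝ → ℝ := fun s => inner ℝ (linearFlow (hamiltonianMap A N Q) s z).2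
        (linearFlow (hamiltonianMap A N Q) s z).1 with hg
  have hmono : Monotone g := h.monotone_pairing z
  have h1 : c * ‖z‖ ^ 2 ≤ g T - g 0 := by
    have := (hinc z 0).1
    change _ ≤ g (0 + T₀) - g 0 at this
    have h2 : g (0 + T₀) ≤ g T := hmono (by linarith)
    simp only [linearFlow_zero] at this
    linarith
  have h2 : c * ‖w‖ ^ 2 ≤ g T - g 0 := by
    have := (hinc z (T - T₀)).2
    rw [sub_add_cancel] at this
    change _ ≤ g T - g (T - T₀) at this
    have h2 : g 0 ≤ g (T - T₀) := hmono (by linarith)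
    linarith
  have h3 : g T - g 0 ≤ ‖w‖ * ‖w.1‖ + ‖z‖ * ‖z.1‖ := by
    have e1 : g T ≤ ‖w‖ * ‖w.1‖ :=
      (real_inner_le_norm _ _).trans (by gcongr; exact norm_snd_le w)
    have e2 : -g 0 ≤ ‖z‖ * ‖z.1‖ := by
      simp only [hg, linearFlow_zero]
      refine (neg_le_abs _).trans ((abs_real_inner_le_norm _ _).trans ?_)
      gcongr
      exact norm_snd_le z
    linarith
  have hs : 0 ≤ ‖z‖ + ‖w‖ := by positivity
  have h4 : c * (‖z‖ + ‖w‖) ^ 2 ≤ 4 * (‖z.1‖ + ‖w.1‖) * (‖z‖ + ‖w‖) := by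
    nlinarith [mul_nonneg hc.le (sq_nonneg (‖z‖ - ‖w‖)), mul_nonneg (norm_nonneg w) (norm_nonneg z.1),
      mul_nonneg (norm_nonneg z) (norm_nonneg w.1)]
  rw [div_mul_eq_mul_div, le_div_iff₀ hc]
  rcases hs.eq_or_lt with h0 | h0
  · rw [← h0]; simp; positivity
  · refine le_of_mul_le_mul_right ?_ h0
    linarith

/-- The two-point boundary value problem for the state is solvable. -/
theorem HamiltonianHyp.exists_boundary_solution (h : HamiltonianHyp A N Q) {T : ℝ} (hT : 0 < T)
    (a b : E) :
    ∃ z : E × E, z.1 = a ∧ (linearFlow (hamiltonianMap A N Q) T z).1 = b := by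
  let S : E × E →ₗ[ℝ] E × E :=
    ((fst ℝ E E).prod (fst ℝ E E ∘L linearFlow (hamiltonianMap A N Q) T)).toLinearMap
  have hS : ∀ z, S z = (z.1, (linearFlow (hamiltonianMap A N Q) T z).1) := fun _ => rfl
  -- If `y` vanishes at both ends, so does the pairing, against its strict increase.
  have hinj : Function.Injective S := by
    refine (injective_iff_map_eq_zero S).2 fun z hz => ?_
    rw [hS, Prod.mk_eq_zero] at hz
    by_contra hne
    have := h.pairing_lt hne hT
    simp [hz.2, hz.1, linearFlow_zero] at this
  obtain ⟨z, hz⟩ := LinearMap.injective_iff_surjective.1 hinj (a, b)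
  rw [hS, Prod.mk.injEq] at hz
  exact ⟨z, hz⟩

/-- A kernel element would be a stationary solution, with constant pairing. Surjectivity is what
solves the static optimality system. -/
theorem HamiltonianHyp.hamiltonianMap_surjective (h : HamiltonianHyp A N Q) :
    Function.Surjective (hamiltonianMap A N Q) := by
  refine LinearMap.surjective_of_injective (f := (hamiltonianMap A N Q).toLinearMap)
    ((injective_iff_map_eq_zero (hamiltonianMap A N Q)).2 fun z hz => ?_)
  by_contra hne
  have := h.pairing_lt hne one_pos
  rw [linearFlow_apply_of_map_eq_zero _ hz, linearFlow_apply_of_map_eq_zero _ hz] at this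
  exact lt_irrefl _ this

end Hamiltonian

/-! ### Integration by parts against absolutely continuous functions. -/

/-- Both factors are absolutely continuous. Only integrability of `w` is available, because
competing controls are merely square integrable. -/
theorem intervalIntegral_deriv_mul_add_mul {f f' w : ℝ → ℝ} {T : ℝ}
    (hf : ∀ t, HasDerivAt f (f' t) t) (hf' : Continuous f') (hw : IntervalIntegrable w volume 0 T) :
    ∫ t in (0 : ℝ)..T, (f' t * (∫ s in (0 : ℝ)..t, w s) + f t * w t) =
      f T * ∫ s in (0 : ℝ)..T, w s := by
  have hg := hw.absolutelyContinuousOnInterval_intervalIntegral (c := 0) (by simp)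
  have hfeq : f = fun t => f 0 + ∫ s in (0 : ℝ)..t, f' s := by
    funext t
    rw [intervalIntegral.integral_eq_sub_of_hasDerivAt (fun s _ => hf s)
      (hf'.intervalIntegrable _ _)]
    ring
  have hfac : AbsolutelyContinuousOnInterval f 0 T := by
    rw [hfeq]
    have h1 : AbsolutelyContinuousOnInterval (fun _ : ℝ => f 0) 0 T :=
      ((LipschitzWith.const (f 0)).lipschitzOnWith).absolutelyContinuousOnInterval
    exact h1.fun_add ((hf'.intervalIntegrable
      0 T).absolutelyContinuousOnInterval_intervalIntegral (c := 0) (by simp))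
  have := hfac.integral_deriv_mul_eq_sub hg
  rw [intervalIntegral.integral_same, mul_zero, sub_zero] at this
  rw [← this]
  refine intervalIntegral.integral_congr_ae ?_
  filter_upwards [hw.ae_hasDerivAt_integral] with t ht htm
  rw [(hf t).deriv, (ht (uIoc_subset_uIcc htm) 0 (by simp)).deriv]

/-- Integration by parts for the inner product of a `C¹` function and an absolutely continuous
function vanishing at `0`. -/
theorem intervalIntegral_inner_deriv_add_inner {d : ℕ} {p p' w : ℝ → EuclideanSpace ℝ (Fin d)}
    {T : ℝ} (hp : ∀ t, HasDerivAt p (p' t) t) (hp' : Continuous p')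
    (hw : IntervalIntegrable w volume 0 T) :
    ∫ t in (0 : ℝ)..T, (inner ℝ (p' t) (∫ s in (0 : ℝ)..t, w s) + inner ℝ (p t) (w t)) =
      inner ℝ (p T) (∫ s in (0 : ℝ)..T, w s) := by
  have hwi : ∀ i, IntervalIntegrable (fun t => w t i) volume 0 T := fun i =>
    ⟨(EuclideanSpace.proj (𝕜 := ℝ) i).integrable_comp hw.1,
      (EuclideanSpace.proj (𝕜 := ℝ) i).integrable_comp hw.2⟩
  have hcoord : ∀ t ∈ uIcc 0 T, ∀ i, (∫ s in (0 : ℝ)..t, w s) i = ∫ s in (0 : ℝ)..t, w s i :=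
    fun t ht i => ((EuclideanSpace.proj (𝕜 := ℝ) i).intervalIntegral_comp_comm
      (hw.mono_set (uIcc_subset_uIcc_left ht))).symm
  have hpc : Continuous p := continuous_iff_continuousAt.2 fun t => (hp t).continuousAt
  have hi : ∀ i, ∫ t in (0 : ℝ)..T, (p' t i * (∫ s in (0 : ℝ)..t, w s i) + p t i * w t i) =
      p T i * ∫ s in (0 : ℝ)..T, w s i := fun i =>
    intervalIntegral_deriv_mul_add_mul
      (fun t => (EuclideanSpace.proj (𝕜 := ℝ) i).hasFDerivAt.comp_hasDerivAt t (hp t))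
      (by fun_prop) (hwi i)
  calc ∫ t in (0 : ℝ)..T, (inner ℝ (p' t) (∫ s in (0 : ℝ)..t, w s) + inner ℝ (p t) (w t))
      = ∫ t in (0 : ℝ)..T, ∑ i, (p' t i * (∫ s in (0 : ℝ)..t, w s i) + p t i * w t i) := by
        refine intervalIntegral.integral_congr fun t ht => ?_
        simp only [PiLp.inner_apply, hcoord t ht, Finset.sum_add_distrib, RCLike.inner_apply,
          conj_trivial, mul_comm]
    _ = ∑ i, p T i * ∫ s in (0 : ℝ)..T, w s i := by
        rw [intervalIntegral.integral_finsetSum]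
        · exact Finset.sum_congr rfl fun i _ => hi i
        · intro i _
          refine IntervalIntegrable.add ?_ ((hwi i).continuousOn_mul (by fun_prop))
          refine ContinuousOn.intervalIntegrable (ContinuousOn.mul (by fun_prop) ?_)
          exact intervalIntegral.continuousOn_primitive_interval' (hwi i) (by simp)
    _ = inner ℝ (p T) (∫ s in (0 : ℝ)..T, w s) := by
        simp only [PiLp.inner_apply, hcoord T (by simp), RCLike.inner_apply, conj_trivial,
          mul_comm]

/-! ### Matrices as operators, and the Kalman condition as observability. -/

theorem Matrix.PosDef.inner_toEuclideanLin_pos {n : ℕ} {M : Matrix (Fin n) (Fin n) ℝ}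
    (hM : M.PosDef) {x : EuclideanSpace ℝ (Fin n)} (hx : x ≠ 0) :
    0 < inner ℝ x (Matrix.toEuclideanLin M x) := by
  have := hM.dotProduct_mulVec_pos (x := x.ofLp) (by simpa using hx)
  simpa [EuclideanSpace.inner_eq_star_dotProduct, dotProduct_comm] using this

theorem Matrix.PosDef.inner_toEuclideanLin_nonneg {n : ℕ} {M : Matrix (Fin n) (Fin n) ℝ}
    (hM : M.PosDef) (x : EuclideanSpace ℝ (Fin n)) :
    0 ≤ inner ℝ x (Matrix.toEuclideanLin M x) := by
  by_cases hx : x = 0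
  · simp [hx]
  · exact (hM.inner_toEuclideanLin_pos hx).le

theorem Matrix.PosDef.inner_toEuclideanLin_comm {n : ℕ} {M : Matrix (Fin n) (Fin n) ℝ}
    (hM : M.PosDef) (x y : EuclideanSpace ℝ (Fin n)) :
    inner ℝ (Matrix.toEuclideanLin M x) y = inner ℝ x (Matrix.toEuclideanLin M y) :=
  Matrix.isSymmetric_toEuclideanLin_iff.2 hM.isHermitian x y

theorem inner_toEuclideanLin_transpose {m n : ℕ} (M : Matrix (Fin m) (Fin n) ℝ)
    (x : EuclideanSpace ℝ (Fin n)) (y : EuclideanSpace ℝ (Fin m)) :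
    inner ℝ (Matrix.toEuclideanLin M.transpose y) x = inner ℝ y (Matrix.toEuclideanLin M x) := by
  rw [← Matrix.conjTranspose_eq_transpose_of_trivial, Matrix.toEuclideanLin_conjTranspose_eq_adjoint,
    LinearMap.adjoint_inner_left]

/-- The relations with `k < d` put `q` in the kernel of the transposed Kalman matrix, which is
trivial since that matrix has rank `d`. -/
theorem KalmanCondition.eq_zero {d r : ℕ} {A : Matrix (Fin d) (Fin d) ℝ}
    {B : Matrix (Fin d) (Fin r) ℝ} (h : KalmanCondition A B) {q : EuclideanSpace ℝ (Fin d)}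
    (hq : ∀ k : ℕ, Matrix.toEuclideanLin B.transpose ((Matrix.toEuclideanLin A.transpose ^ k) q) = 0) : q = 0 := by
  have hpow : ∀ k : ℕ, ((Matrix.toEuclideanLin A.transpose ^ k) q).ofLp = (A.transpose ^ k).mulVec q.ofLp := by
    intro k
    induction k with
    | zero => simp
    | succ k ih => rw [pow_succ', pow_succ', Module.End.mul_apply, ← Matrix.mulVec_mulVec, ← ih]; rfl
  have hK : (kalmanMatrix A B).transpose.mulVecLin q.ofLp = 0 := by
    ext ⟨k, j⟩
    have h1 : (B.transpose.mulVec ((A.transpose ^ (k : ℕ)).mulVec q.ofLp)) j = 0 := by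
      rw [← hpow]
      exact congrArg (fun v : EuclideanSpace ℝ (Fin r) => v j) (hq k)
    rw [Matrix.mulVec_mulVec, ← Matrix.transpose_pow, ← Matrix.transpose_mul] at h1
    exact h1
  have hrank : Module.finrank ℝ (LinearMap.range (kalmanMatrix A B).transpose.mulVecLin) = d := by
    have := Matrix.rank_transpose (kalmanMatrix A B)
    rw [KalmanCondition] at h
    rw [h] at this
    exact this
  have hker := LinearMap.finrank_range_add_finrank_ker (kalmanMatrix A B).transpose.mulVecLin
  rw [hrank, Module.finrank_fin_fun, Nat.add_eq_left, Submodule.finrank_eq_zero] at hker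
  have := (LinearMap.ker_eq_bot'.1 hker) _ hK
  exact (WithLp.ofLp_eq_zero 2).1 this

/-! ### The control problem: Hamiltonian structure, cost expansion and gradients. -/

namespace LQProblem

variable {d r : ℕ} (P : LQProblem d r)

/-- The matrix `A` as a continuous linear map. -/
noncomputable def mapA : EuclideanSpace ℝ (Fin d) →L[ℝ] EuclideanSpace ℝ (Fin d) :=
  LinearMap.toContinuousLinearMap (Matrix.toEuclideanLin P.A)

/-- The matrix `B` as a continuous linear map. -/
noncomputable def mapB : EuclideanSpace ℝ (Fin r) →L[ℝ] EuclideanSpace ℝ (Fin d) :=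
  LinearMap.toContinuousLinearMap (Matrix.toEuclideanLin P.B)

/-- The matrix `Q` as a continuous linear map. -/
noncomputable def mapQ : EuclideanSpace ℝ (Fin d) →L[ℝ] EuclideanSpace ℝ (Fin d) :=
  LinearMap.toContinuousLinearMap (Matrix.toEuclideanLin P.Q)

/-- The matrix `R` as a continuous linear map. -/
noncomputable def mapR : EuclideanSpace ℝ (Fin r) →L[ℝ] EuclideanSpace ℝ (Fin r) :=
  LinearMap.toContinuousLinearMap (Matrix.toEuclideanLin P.R)

/-- The feedback `R⁻¹ B†` giving the control from the adjoint vector. -/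
noncomputable def feedback : EuclideanSpace ℝ (Fin d) →L[ℝ] EuclideanSpace ℝ (Fin r) :=
  LinearMap.toContinuousLinearMap (Matrix.toEuclideanLin P.R⁻¹) ∘L P.mapB.adjoint

theorem dynamics_eq (x : EuclideanSpace ℝ (Fin d)) (u : EuclideanSpace ℝ (Fin r)) :
    P.dynamics x u = P.mapA x + P.mapB u := rfl

theorem runningCost_eq (x : EuclideanSpace ℝ (Fin d)) (u : EuclideanSpace ℝ (Fin r)) :
    P.runningCost x u = inner ℝ (x - P.xhat) (P.mapQ (x - P.xhat)) +
      inner ℝ (u - P.uhat) (P.mapR (u - P.uhat)) := rfl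

theorem adjoint_mapA_apply (q : EuclideanSpace ℝ (Fin d)) :
    P.mapA.adjoint q = Matrix.toEuclideanLin P.A.transpose q :=
  ext_inner_right ℝ fun x => by
    rw [ContinuousLinearMap.adjoint_inner_left, inner_toEuclideanLin_transpose]; rfl

theorem adjoint_mapB_apply (q : EuclideanSpace ℝ (Fin d)) :
    P.mapB.adjoint q = Matrix.toEuclideanLin P.B.transpose q :=
  ext_inner_right ℝ fun x => by
    rw [ContinuousLinearMap.adjoint_inner_left, inner_toEuclideanLin_transpose]; rfl

theorem adjoint_mapA_pow_apply (k : ℕ) (q : EuclideanSpace ℝ (Fin d)) :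
    (P.mapA.adjoint ^ k) q = (Matrix.toEuclideanLin P.A.transpose ^ k) q := by
  induction k with
  | zero => simp
  | succ k ih =>
    rw [pow_succ', pow_succ', mul_apply_eq_comp, ih, adjoint_mapA_apply,
      Module.End.mul_apply]

variable {P}

theorem observable (hAB : KalmanCondition P.A P.B) (q : EuclideanSpace ℝ (Fin d))
    (hq : ∀ k : ℕ, P.mapB.adjoint ((P.mapA.adjoint ^ k) q) = 0) : q = 0 :=
  hAB.eq_zero fun k => by rw [← adjoint_mapA_pow_apply, ← adjoint_mapB_apply, hq k]

theorem mapR_feedback (hR : P.R.PosDef) (q : EuclideanSpace ℝ (Fin d)) :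
    P.mapR (P.feedback q) = P.mapB.adjoint q := by
  have h : Matrix.toEuclideanLin P.R (Matrix.toEuclideanLin P.R⁻¹ (P.mapB.adjoint q)) =
      P.mapB.adjoint q := by
    apply WithLp.ofLp_injective
    simp [Matrix.mulVec_mulVec, Matrix.mul_nonsing_inv _ ((Matrix.isUnit_iff_isUnit_det _).1 hR.isUnit)]
  exact h

theorem inner_mapB_feedback (hR : P.R.PosDef) (q : EuclideanSpace ℝ (Fin d)) :
    inner ℝ q (P.mapB (P.feedback q)) = inner ℝ (P.feedback q) (P.mapR (P.feedback q)) := by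
  rw [mapR_feedback hR, ← ContinuousLinearMap.adjoint_inner_left, real_inner_comm]

/-- With `F = R⁻¹ B†` one has `⟨q, N q⟩ = ⟨F q, R (F q)⟩`. Its vanishing forces `F q = 0`, hence `B†
q = R (F q) = 0`, so observability through `N` reduces to observability through `B†`. -/
theorem hamiltonianHyp (hQ : P.Q.PosDef) (hR : P.R.PosDef) (hAB : KalmanCondition P.A P.B) :
    HamiltonianHyp P.mapA (P.mapB ∘L P.feedback) P.mapQ := by
  have hN : ∀ q, inner ℝ q (P.mapB (P.feedback q)) = 0 → P.feedback q = 0 := by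
    intro q hq
    by_contra hne
    rw [inner_mapB_feedback hR] at hq
    exact (hR.inner_toEuclideanLin_pos hne).ne' hq
  refine ⟨fun x hx => hQ.inner_toEuclideanLin_pos hx, fun q => ?_, fun q hq => ?_, fun q hq => ?_⟩
  · change 0 ≤ inner ℝ q (P.mapB (P.feedback q))
    rw [inner_mapB_feedback hR]
    exact hR.inner_toEuclideanLin_nonneg _
  · change P.mapB (P.feedback q) = 0
    rw [hN q hq, map_zero]
  · refine observable hAB q fun k => ?_
    have hk : P.mapB (P.feedback ((P.mapA.adjoint ^ k) q)) = 0 := hq k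
    rw [← mapR_feedback hR, hN _ (by rw [hk, inner_zero_right]), map_zero]

theorem inner_mapQ_comm (hQ : P.Q.PosDef) (x y : EuclideanSpace ℝ (Fin d)) :
    inner ℝ (P.mapQ x) y = inner ℝ x (P.mapQ y) := hQ.inner_toEuclideanLin_comm x y

theorem inner_mapR_comm (hR : P.R.PosDef) (x y : EuclideanSpace ℝ (Fin r)) :
    inner ℝ (P.mapR x) y = inner ℝ x (P.mapR y) := hR.inner_toEuclideanLin_comm x y

/-- The exact second-order Taylor expansion; symmetry of `Q` and `R` merges the cross terms. The
static and dynamic optimality proofs both cancel its linear part. -/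
theorem runningCost_expand (hQ : P.Q.PosDef) (hR : P.R.PosDef)
    (x x' : EuclideanSpace ℝ (Fin d)) (u u' : EuclideanSpace ℝ (Fin r)) :
    P.runningCost x' u' = P.runningCost x u +
      2 * (inner ℝ (P.mapQ (x - P.xhat)) (x' - x) + inner ℝ (P.mapR (u - P.uhat)) (u' - u)) +
      (inner ℝ (x' - x) (P.mapQ (x' - x)) + inner ℝ (u' - u) (P.mapR (u' - u))) := by
  have hx : x' - P.xhat = (x - P.xhat) + (x' - x) := by abel
  have hu : u' - P.uhat = (u - P.uhat) + (u' - u) := by abel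
  rw [runningCost_eq, runningCost_eq, hx, hu]
  simp only [map_add, inner_add_left, inner_add_right]
  rw [← inner_mapQ_comm hQ (x - P.xhat) (x' - x), ← inner_mapR_comm hR (u - P.uhat) (u' - u),
    real_inner_comm (P.mapQ (x - P.xhat)) (x' - x), real_inner_comm (P.mapR (u - P.uhat)) (u' - u)]
  ring

theorem quadratic_nonneg (hQ : P.Q.PosDef) (hR : P.R.PosDef)
    (y : EuclideanSpace ℝ (Fin d)) (v : EuclideanSpace ℝ (Fin r)) :
    0 ≤ inner ℝ y (P.mapQ y) + inner ℝ v (P.mapR v) :=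
  add_nonneg (hQ.inner_toEuclideanLin_nonneg y) (hR.inner_toEuclideanLin_nonneg v)

theorem eq_zero_of_quadratic_le (hQ : P.Q.PosDef) (hR : P.R.PosDef)
    {y : EuclideanSpace ℝ (Fin d)} {v : EuclideanSpace ℝ (Fin r)}
    (h : inner ℝ y (P.mapQ y) + inner ℝ v (P.mapR v) ≤ 0) : y = 0 ∧ v = 0 := by
  have h1 : 0 ≤ inner ℝ y (P.mapQ y) := hQ.inner_toEuclideanLin_nonneg y
  have h2 : 0 ≤ inner ℝ v (P.mapR v) := hR.inner_toEuclideanLin_nonneg v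
  constructor <;> by_contra hne
  · have h3 : 0 < inner ℝ y (P.mapQ y) := hQ.inner_toEuclideanLin_pos hne
    linarith
  · have h3 : 0 < inner ℝ v (P.mapR v) := hR.inner_toEuclideanLin_pos hne
    linarith

/-- The cost multiplier `-1/2` cancels the factor 2 from differentiating a symmetric quadratic form.
-/
theorem hasGradientAt_hamiltonian_state (hQ : P.Q.PosDef) (x p : EuclideanSpace ℝ (Fin d))
    (u : EuclideanSpace ℝ (Fin r)) :
    HasGradientAt (fun ξ => P.hamiltonian ξ p (-1 / 2) u)
      (P.mapA.adjoint p - P.mapQ (x - P.xhat)) x := by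
  rw [hasGradientAt_iff_hasFDerivAt]
  have h1 : HasFDerivAt (fun ξ => P.dynamics ξ u) P.mapA x :=
    P.mapA.hasFDerivAt.add_const (P.mapB u)
  have h2 : HasFDerivAt (fun ξ => ξ - P.xhat)
      (ContinuousLinearMap.id ℝ (EuclideanSpace ℝ (Fin d))) x := (hasFDerivAt_id x).sub_const P.xhat
  have h3 := ((hasFDerivAt_const p x).inner ℝ h1).add
    (((h2.inner ℝ (P.mapQ.hasFDerivAt.comp x h2)).add_const
      (inner ℝ (u - P.uhat) (P.mapR (u - P.uhat)))).const_mul (-1 / 2))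
  refine h3.congr_fderiv ?_
  ext y
  have e₁ := inner_mapQ_comm hQ (x - P.xhat) y
  have e₂ := real_inner_comm y (P.mapQ (x - P.xhat))
  simp [fderivInnerCLM_apply, inner_sub_left, inner_sub_right,
    ContinuousLinearMap.adjoint_inner_left] at e₁ e₂ ⊢
  linarith

theorem hasGradientAt_hamiltonian_control (hR : P.R.PosDef) (x p : EuclideanSpace ℝ (Fin d))
    (u : EuclideanSpace ℝ (Fin r)) :
    HasGradientAt (fun v => P.hamiltonian x p (-1 / 2) v)
      (P.mapB.adjoint p - P.mapR (u - P.uhat)) u := by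
  rw [hasGradientAt_iff_hasFDerivAt]
  have h1 : HasFDerivAt (fun v => P.dynamics x v) P.mapB u :=
    P.mapB.hasFDerivAt.const_add (P.mapA x)
  have h2 : HasFDerivAt (fun v => v - P.uhat)
      (ContinuousLinearMap.id ℝ (EuclideanSpace ℝ (Fin r))) u := (hasFDerivAt_id u).sub_const P.uhat
  have h3 := ((hasFDerivAt_const p u).inner ℝ h1).add
    (((h2.inner ℝ (P.mapR.hasFDerivAt.comp u h2)).const_add
      (inner ℝ (x - P.xhat) (P.mapQ (x - P.xhat)))).const_mul (-1 / 2))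
  refine h3.congr_fderiv ?_
  ext y
  have e₁ := inner_mapR_comm hR (u - P.uhat) y
  have e₂ := real_inner_comm y (P.mapR (u - P.uhat))
  simp [fderivInnerCLM_apply, inner_sub_left, inner_sub_right,
    ContinuousLinearMap.adjoint_inner_left] at e₁ e₂ ⊢
  linarith

/-- The control maximizes the Hamiltonian iff `R (u - û) = B† p`. -/
theorem hamiltonian_le_iff (hQ : P.Q.PosDef) (hR : P.R.PosDef) (x p : EuclideanSpace ℝ (Fin d))
    (u : EuclideanSpace ℝ (Fin r)) :
    (∀ v, P.hamiltonian x p (-1 / 2) v ≤ P.hamiltonian x p (-1 / 2) u) ↔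
      P.mapR (u - P.uhat) = P.mapB.adjoint p := by
  constructor
  · intro h
    have h0 := IsLocalMax.hasFDerivAt_eq_zero (Filter.Eventually.of_forall h)
      (hasGradientAt_hamiltonian_control hR x p u).hasFDerivAt
    rw [map_eq_zero_iff _ (InnerProductSpace.toDual ℝ _).injective, sub_eq_zero] at h0
    exact h0.symm
  · intro h v
    have h1 := runningCost_expand hQ hR x x u v
    have h2 : inner ℝ p (P.dynamics x v) =
        inner ℝ p (P.dynamics x u) + inner ℝ (P.mapB.adjoint p) (v - u) := by
      rw [ContinuousLinearMap.adjoint_inner_left, dynamics_eq, dynamics_eq, map_sub,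
        ← inner_add_right]
      congr 1; abel
    have h3 := quadratic_nonneg hQ hR (x - x) (v - u)
    rw [h] at h1
    simp only [sub_self, inner_zero_right] at h1 h3
    simp only [hamiltonian]
    rw [h1, h2]
    simp only [map_zero, inner_zero_right] at h3 ⊢
    linarith

/-- A triple solving the static optimality system. -/
theorem exists_static_solution (hQ : P.Q.PosDef) (hR : P.R.PosDef)
    (hAB : KalmanCondition P.A P.B) :
    ∃ x u p, P.dynamics x u = 0 ∧ P.mapQ (x - P.xhat) = P.mapA.adjoint p ∧
      u = P.uhat + P.feedback p := by
  -- The right-hand side collects the affine terms of the static system, which come from the targets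
  -- `û` and `x̂`.
  obtain ⟨z, hz⟩ := (hamiltonianHyp hQ hR hAB).hamiltonianMap_surjective
    (-P.mapB P.uhat, P.mapQ P.xhat)
  rw [hamiltonianMap_apply, Prod.mk.injEq] at hz
  refine ⟨z.1, P.uhat + P.feedback z.2, z.2, ?_, ?_, rfl⟩
  · have h := hz.1
    rw [ContinuousLinearMap.comp_apply] at h
    rw [dynamics_eq, map_add, add_left_comm, h, add_neg_cancel]
  · rw [map_sub, ← hz.2]; abel

theorem mapR_sub_uhat (hR : P.R.PosDef) {u : EuclideanSpace ℝ (Fin r)}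
    {p : EuclideanSpace ℝ (Fin d)} (hu : u = P.uhat + P.feedback p) :
    P.mapR (u - P.uhat) = P.mapB.adjoint p := by
  rw [hu, add_sub_cancel_left, mapR_feedback hR]

/-! ### The static problem and its multiplier. -/

section Static

variable {xbar : EuclideanSpace ℝ (Fin d)} {ubar : EuclideanSpace ℝ (Fin r)}
  {pbar : EuclideanSpace ℝ (Fin d)}

/-- The linear term of the expansion is twice `⟨pbar, A δx + B δu⟩`, which is zero between two
equilibria. -/
theorem static_runningCost (hQ : P.Q.PosDef) (hR : P.R.PosDef) (hdyn : P.dynamics xbar ubar = 0)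
    (hx : P.mapQ (xbar - P.xhat) = P.mapA.adjoint pbar)
    (hu : P.mapR (ubar - P.uhat) = P.mapB.adjoint pbar)
    {x : EuclideanSpace ℝ (Fin d)} {u : EuclideanSpace ℝ (Fin r)} (h : P.dynamics x u = 0) :
    P.runningCost x u = P.runningCost xbar ubar +
      (inner ℝ (x - xbar) (P.mapQ (x - xbar)) + inner ℝ (u - ubar) (P.mapR (u - ubar))) := by
  rw [runningCost_expand hQ hR xbar x ubar u, hx, hu, ContinuousLinearMap.adjoint_inner_left,
    ContinuousLinearMap.adjoint_inner_left, ← inner_add_right]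
  have : P.mapA (x - xbar) + P.mapB (u - ubar) = P.dynamics x u - P.dynamics xbar ubar := by
    rw [dynamics_eq, dynamics_eq, map_sub, map_sub]; abel
  rw [this, h, hdyn, sub_zero, inner_zero_right, mul_zero, add_zero]

theorem isStaticOptimum_of_stationary (hQ : P.Q.PosDef) (hR : P.R.PosDef)
    (hdyn : P.dynamics xbar ubar = 0) (hx : P.mapQ (xbar - P.xhat) = P.mapA.adjoint pbar)
    (hu : P.mapR (ubar - P.uhat) = P.mapB.adjoint pbar) :
    P.IsStaticOptimum xbar ubar ∧
      ∀ x u, P.IsStaticOptimum x u → x = xbar ∧ u = ubar := by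
  refine ⟨⟨hdyn, fun x u h => ?_⟩, fun x u h => ?_⟩
  · rw [static_runningCost hQ hR hdyn hx hu h]
    linarith [quadratic_nonneg hQ hR (x - xbar) (u - ubar)]
  · have h1 := h.2 xbar ubar hdyn
    rw [static_runningCost hQ hR hdyn hx hu h.1] at h1
    have h2 := eq_zero_of_quadratic_le hQ hR (y := x - xbar) (v := u - ubar) (by linarith)
    exact ⟨sub_eq_zero.1 h2.1, sub_eq_zero.1 h2.2⟩

theorem isStaticMultiplier_iff (hQ : P.Q.PosDef) (hR : P.R.PosDef)
    (p : EuclideanSpace ℝ (Fin d)) :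
    P.IsStaticMultiplier xbar ubar p ↔ P.mapQ (xbar - P.xhat) = P.mapA.adjoint p ∧
      P.mapR (ubar - P.uhat) = P.mapB.adjoint p := by
  rw [IsStaticMultiplier, (hasGradientAt_hamiltonian_state hQ xbar p ubar).gradient,
    (hasGradientAt_hamiltonian_control hR xbar p ubar).gradient, sub_eq_zero, sub_eq_zero,
    eq_comm, eq_comm (b := P.mapR _)]

/-- The difference of two multipliers is killed by both `A†` and `B†`, so observability applies. -/
theorem staticMultiplier_unique (hQ : P.Q.PosDef) (hR : P.R.PosDef)
    (hAB : KalmanCondition P.A P.B) {p p' : EuclideanSpace ℝ (Fin d)}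
    (hp : P.IsStaticMultiplier xbar ubar p) (hp' : P.IsStaticMultiplier xbar ubar p') : p' = p := by
  rw [isStaticMultiplier_iff hQ hR] at hp hp'
  refine sub_eq_zero.1 (observable hAB _ fun k => ?_)
  cases k with
  | zero => simp [← hp.2, ← hp'.2]
  | succ k => simp [pow_succ, ← hp.1, ← hp'.1]

end Static

/-! ### Extremals: optimality, uniqueness and the adjoint vector. -/

/-- Classical solutions of the optimality system with the prescribed end points. -/
structure IsExtremal (P : LQProblem d r) (T : ℝ) (x : ℝ → EuclideanSpace ℝ (Fin d))
    (u : ℝ → EuclideanSpace ℝ (Fin r)) (p : ℝ → EuclideanSpace ℝ (Fin d)) : Prop where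
  hasDerivAt_state : ∀ t, HasDerivAt x (P.dynamics (x t) (u t)) t
  hasDerivAt_adjoint :
    ∀ t, HasDerivAt p (P.mapQ (x t - P.xhat) - P.mapA.adjoint (p t)) t
  control_eq : ∀ t, u t = P.uhat + P.feedback (p t)
  state_zero : x 0 = P.x₀
  state_final : x T = P.x₁

section Extremal

variable {T : ℝ} {x p : ℝ → EuclideanSpace ℝ (Fin d)} {u : ℝ → EuclideanSpace ℝ (Fin r)}

theorem IsExtremal.continuous_state (h : P.IsExtremal T x u p) : Continuous x :=
  continuous_iff_continuousAt.2 fun t => (h.hasDerivAt_state t).continuousAt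

theorem IsExtremal.continuous_adjoint (h : P.IsExtremal T x u p) : Continuous p :=
  continuous_iff_continuousAt.2 fun t => (h.hasDerivAt_adjoint t).continuousAt

theorem IsExtremal.continuous_control (h : P.IsExtremal T x u p) : Continuous u := by
  have hp := h.continuous_adjoint
  rw [funext h.control_eq]
  fun_prop

theorem IsExtremal.isAdmissible (h : P.IsExtremal T x u p) : P.IsAdmissible T x u := by
  have hx := h.continuous_state
  have hu := h.continuous_control
  refine ⟨?_, hx.continuousOn, fun t _ => ?_, h.state_final⟩
  · obtain ⟨C, hC⟩ := (isCompact_Icc (a := (0 : ℝ)) (b := T)).exists_bound_of_continuousOn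
      hu.continuousOn
    exact MemLp.of_bound hu.aestronglyMeasurable C
      ((ae_restrict_mem measurableSet_Icc).mono hC)
  · rw [intervalIntegral.integral_eq_sub_of_hasDerivAt (fun s _ => h.hasDerivAt_state s), h.state_zero]
    · abel
    · have : Continuous fun s => P.dynamics (x s) (u s) := by
        simp only [dynamics_eq]; fun_prop
      exact this.intervalIntegrable _ _

theorem IsExtremal.isNormalAdjoint (hQ : P.Q.PosDef) (hR : P.R.PosDef)
    (h : P.IsExtremal T x u p) : P.IsNormalAdjoint T x u p := by
  have hx := h.continuous_state
  have hp := h.continuous_adjoint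
  refine ⟨hp.continuousOn, fun t _ => ?_, Filter.Eventually.of_forall fun t =>
    (hamiltonian_le_iff hQ hR _ _ _).2 (mapR_sub_uhat hR (h.control_eq t))⟩
  have hgrad : ∀ s, -gradient (fun ξ => P.hamiltonian ξ (p s) (-1 / 2) (u s)) (x s) =
      P.mapQ (x s - P.xhat) - P.mapA.adjoint (p s) := fun s => by
    rw [(hasGradientAt_hamiltonian_state hQ (x s) (p s) (u s)).gradient, neg_sub]
  simp only [hgrad]
  rw [intervalIntegral.integral_eq_sub_of_hasDerivAt (fun s _ => h.hasDerivAt_adjoint s)]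
  · abel
  · exact Continuous.intervalIntegrable (by fun_prop) _ _

/-- The difference `δ` of two adjoints solves `δ' = -A† δ`, and the two maximum conditions give `B†
δ = 0` almost everywhere, hence everywhere by continuity. Observability gives `δ = 0`. -/
theorem IsNormalAdjoint.eqOn (hQ : P.Q.PosDef) (hR : P.R.PosDef) (hAB : KalmanCondition P.A P.B)
    (hT : 0 < T) (hx : ContinuousOn x (Icc 0 T)) (hp : P.IsNormalAdjoint T x u p)
    {p' : ℝ → EuclideanSpace ℝ (Fin d)} (hp' : P.IsNormalAdjoint T x u p') :
    EqOn p' p (Icc 0 T) := by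
  have hderiv : ∀ {π : ℝ → EuclideanSpace ℝ (Fin d)}, P.IsNormalAdjoint T x u π →
      ∀ t ∈ Ioo 0 T, HasDerivAt π (P.mapQ (x t - P.xhat) - P.mapA.adjoint (π t)) t := by
    intro π hπ t ht
    -- The control drops out of the state gradient of the Hamiltonian, so the integrand is
    -- continuous and the adjoint is differentiable at every interior time.
    have hc : ContinuousOn (fun s => P.mapQ (x s - P.xhat) - P.mapA.adjoint (π s)) (Icc 0 T) := by
      have := hπ.continuousOn_adjoint
      fun_prop
    have hI : HasDerivAt (fun t => π 0 + ∫ s in (0 : ℝ)..t,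
        (P.mapQ (x s - P.xhat) - P.mapA.adjoint (π s)))
        (P.mapQ (x t - P.xhat) - P.mapA.adjoint (π t)) t := by
      have hIcc : Icc 0 T ∈ nhds t := Icc_mem_nhds ht.1 ht.2
      refine (intervalIntegral.integral_hasDerivAt_right ?_ ?_ (hc.continuousAt hIcc)).const_add _
      · refine ContinuousOn.intervalIntegrable (hc.mono ?_)
        rw [uIcc_of_le ht.1.le]
        exact Icc_subset_Icc_right ht.2.le
      · exact ⟨Icc 0 T, hIcc, hc.aestronglyMeasurable measurableSet_Icc⟩
    refine hI.congr_of_eventuallyEq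
      (Filter.eventually_of_mem (Ioo_mem_nhds ht.1 ht.2) fun s hs => ?_)
    rw [hπ.adjoint_eq s (Ioo_subset_Icc_self hs)]
    congr 1
    refine intervalIntegral.integral_congr fun s _ => ?_
    simp only [(hasGradientAt_hamiltonian_state hQ (x s) (π s) (u s)).gradient, neg_sub]
  have hcont : ContinuousOn (fun t => p' t - p t) (Icc 0 T) :=
    hp'.continuousOn_adjoint.sub hp.continuousOn_adjoint
  have hB : EqOn (fun t => P.mapB.adjoint (p' t - p t)) (fun _ => 0) (Icc 0 T) := by
    refine Measure.eqOn_Icc_of_ae_eq volume hT.ne ?_ (by fun_prop) continuousOn_const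
    filter_upwards [hp.maximum_condition, hp'.maximum_condition] with t h1 h2
    rw [hamiltonian_le_iff hQ hR] at h1 h2
    rw [map_sub, ← h1, ← h2, sub_self]
  have hzero : ∀ t ∈ Ioo 0 T, p' t - p t = 0 := by
    refine eq_zero_of_unobserved (A := P.mapA) (N := P.mapB.adjoint) (observable hAB)
      (fun t ht => ?_) fun t ht => hB (Ioo_subset_Icc_self ht)
    refine ((hderiv hp' t ht).sub (hderiv hp t ht)).congr_deriv ?_
    rw [map_sub _ (p' t)]; abel
  have hae : (fun t => p' t - p t) =ᵐ[volume.restrict (Icc 0 T)] fun _ => 0 := by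
    rw [← restrict_Ioo_eq_restrict_Icc]
    exact (ae_restrict_mem measurableSet_Ioo).mono fun t ht => hzero t ht
  intro t ht
  exact sub_eq_zero.1 (Measure.eqOn_Icc_of_ae_eq volume hT.ne hae hcont continuousOn_const ht)

theorem IsAdmissible.intervalIntegrable_control (h : P.IsAdmissible T x u) (hT : 0 < T) :
    IntervalIntegrable u volume 0 T := by
  rw [intervalIntegrable_iff_integrableOn_Icc_of_le hT.le]
  exact h.memLp_control.integrable (by norm_num)

theorem IsAdmissible.intervalIntegrable_dynamics (h : P.IsAdmissible T x u) (hT : 0 < T) :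
    IntervalIntegrable (fun t => P.dynamics (x t) (u t)) volume 0 T := by
  have h1 : IntervalIntegrable (fun t => P.mapA (x t)) volume 0 T := by
    refine ContinuousOn.intervalIntegrable ?_
    rw [uIcc_of_le hT.le]
    have := h.continuousOn_state
    fun_prop
  have hu := h.intervalIntegrable_control hT
  exact h1.add ⟨P.mapB.integrable_comp hu.1, P.mapB.integrable_comp hu.2⟩

/-- The second variation of the cost is integrable. -/
theorem IsExtremal.intervalIntegrable_quadratic (h : P.IsExtremal T x u p) (hT : 0 < T)
    {x' : ℝ → EuclideanSpace ℝ (Fin d)} {u' : ℝ → EuclideanSpace ℝ (Fin r)}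
    (h' : P.IsAdmissible T x' u') :
    IntervalIntegrable (fun t => inner ℝ (x' t - x t) (P.mapQ (x' t - x t)) +
      inner ℝ (u' t - u t) (P.mapR (u' t - u t))) volume 0 T := by
  have hx := h.continuous_state
  have hx' := h'.continuousOn_state
  refine IntervalIntegrable.add ?_ ?_
  · refine ContinuousOn.intervalIntegrable ?_
    rw [uIcc_of_le hT.le]
    fun_prop
  · rw [intervalIntegrable_iff_integrableOn_Icc_of_le hT.le]
    have hv : MemLp (fun t => u' t - u t) 2 (volume.restrict (Icc 0 T)) :=
      h'.memLp_control.sub h.isAdmissible.memLp_control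
    have hRv : MemLp (fun t => P.mapR (u' t - u t)) 2 (volume.restrict (Icc 0 T)) :=
      P.mapR.comp_memLp' hv
    refine ((hv.norm.mul' hRv.norm (r := 1)).integrable le_rfl).mono'
      (hv.1.inner hRv.1) (Filter.Eventually.of_forall fun t => ?_)
    simpa [mul_comm] using norm_inner_le_norm (𝕜 := ℝ) (u' t - u t) (P.mapR (u' t - u t))

/-- Along an extremal the cost of a competitor is the sum of the optimal cost and the second
variation. -/
theorem IsExtremal.cost_eq (hQ : P.Q.PosDef) (hR : P.R.PosDef) (h : P.IsExtremal T x u p)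
    (hT : 0 < T) {x' : ℝ → EuclideanSpace ℝ (Fin d)} {u' : ℝ → EuclideanSpace ℝ (Fin r)}
    (h' : P.IsAdmissible T x' u') :
    P.cost T x' u' = P.cost T x u + ∫ t in (0 : ℝ)..T,
      (inner ℝ (x' t - x t) (P.mapQ (x' t - x t)) +
        inner ℝ (u' t - u t) (P.mapR (u' t - u t))) := by
  have hx := h.continuous_state
  have hp := h.continuous_adjoint
  have hu := h.continuous_control
  have hx' := h'.continuousOn_state
  set w : ℝ → EuclideanSpace ℝ (Fin d) :=
    fun t => P.dynamics (x' t) (u' t) - P.dynamics (x t) (u t) with hwdef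
  have hd' := h'.intervalIntegrable_dynamics hT
  have hd := h.isAdmissible.intervalIntegrable_dynamics hT
  have hw : IntervalIntegrable w volume 0 T := hd'.sub hd
  have hδ : ∀ t ∈ Icc 0 T, ∫ s in (0 : ℝ)..t, w s = x' t - x t := by
    intro t ht
    have hsub : uIcc 0 t ⊆ uIcc 0 T := by
      rw [uIcc_of_le ht.1, uIcc_of_le hT.le]; exact Icc_subset_Icc_right ht.2
    rw [h'.state_eq t ht, h.isAdmissible.state_eq t ht, hwdef,
      intervalIntegral.integral_sub (hd'.mono_set hsub) (hd.mono_set hsub)]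
    abel
  have hwt : ∀ t, w t = P.mapA (x' t - x t) + P.mapB (u' t - u t) := fun t => by
    simp only [hwdef, dynamics_eq, map_sub]; abel
  -- This is the derivative of `⟨p, x' - x⟩` and also half the linear part of the cost expansion;
  -- its integral vanishes because the end points agree.
  set g : ℝ → ℝ := fun t => inner ℝ (P.mapQ (x t - P.xhat) - P.mapA.adjoint (p t))
    (∫ s in (0 : ℝ)..t, w s) + inner ℝ (p t) (w t) with hgdef
  have hcross : ∫ t in (0 : ℝ)..T, g t = 0 := by
    rw [hgdef, intervalIntegral_inner_deriv_add_inner h.hasDerivAt_adjoint (by fun_prop) hw,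
      hδ T (right_mem_Icc.2 hT.le), h'.final_eq, h.state_final, sub_self, inner_zero_right]
  have hgint : IntervalIntegrable g volume 0 T := by
    refine IntervalIntegrable.add ?_ ?_
    · refine ContinuousOn.intervalIntegrable (ContinuousOn.inner ?_
        (intervalIntegral.continuousOn_primitive_interval' hw (by simp)))
      fun_prop
    · obtain ⟨C, hC⟩ := (isCompact_Icc (a := (0 : ℝ)) (b := T)).exists_bound_of_continuousOn
        hp.continuousOn
      rw [intervalIntegrable_iff_integrableOn_Icc_of_le hT.le] at hw ⊢
      refine (hw.norm.const_mul C).mono' (hp.aestronglyMeasurable.inner hw.1)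
        ((ae_restrict_mem measurableSet_Icc).mono fun t ht => ?_)
      exact (norm_inner_le_norm _ _).trans (by gcongr; exact hC t ht)
  have hcint : IntervalIntegrable (fun t => P.runningCost (x t) (u t)) volume 0 T := by
    simp only [runningCost_eq]
    exact Continuous.intervalIntegrable (by fun_prop) _ _
  have hqint := h.intervalIntegrable_quadratic hT h'
  have hpt : ∀ t ∈ uIcc 0 T, P.runningCost (x' t) (u' t) = P.runningCost (x t) (u t) + 2 * g t +
      (inner ℝ (x' t - x t) (P.mapQ (x' t - x t)) +
        inner ℝ (u' t - u t) (P.mapR (u' t - u t))) := by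
    intro t ht
    rw [uIcc_of_le hT.le] at ht
    rw [runningCost_expand hQ hR (x t) (x' t) (u t) (u' t), hgdef]
    simp only [hδ t ht]
    rw [hwt, mapR_sub_uhat hR (h.control_eq t), inner_sub_left (P.mapQ _),
      inner_add_right, ContinuousLinearMap.adjoint_inner_left,
      ContinuousLinearMap.adjoint_inner_left]
    ring
  rw [cost, intervalIntegral.integral_congr hpt,
    intervalIntegral.integral_add (hcint.add (hgint.const_mul 2)) hqint,
    intervalIntegral.integral_add hcint (hgint.const_mul 2),
    intervalIntegral.integral_const_mul, hcross, mul_zero, add_zero, cost]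

theorem IsExtremal.isOptimal (hQ : P.Q.PosDef) (hR : P.R.PosDef) (h : P.IsExtremal T x u p)
    (hT : 0 < T) : P.IsOptimal T x u :=
  ⟨h.isAdmissible, fun x' u' h' => by
    rw [h.cost_eq hQ hR hT h']
    have := intervalIntegral.integral_nonneg (μ := volume) hT.le
      fun t _ => quadratic_nonneg hQ hR (x' t - x t) (u' t - u t)
    linarith⟩

/-- A second optimum has zero second variation, so states and controls agree almost everywhere;
continuity upgrades this for the states. -/
theorem IsExtremal.unique (hQ : P.Q.PosDef) (hR : P.R.PosDef) (h : P.IsExtremal T x u p)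
    (hT : 0 < T) {x' : ℝ → EuclideanSpace ℝ (Fin d)} {u' : ℝ → EuclideanSpace ℝ (Fin r)}
    (h' : P.IsOptimal T x' u') :
    EqOn x' x (Icc 0 T) ∧ u' =ᵐ[volume.restrict (Icc 0 T)] u := by
  have h1 := h'.2 x u h.isAdmissible
  rw [h.cost_eq hQ hR hT h'.1] at h1
  have hqint := h.intervalIntegrable_quadratic hT h'.1
  have hnn : ∀ t, 0 ≤ inner ℝ (x' t - x t) (P.mapQ (x' t - x t)) +
        inner ℝ (u' t - u t) (P.mapR (u' t - u t)) :=
    fun t => quadratic_nonneg hQ hR (x' t - x t) (u' t - u t)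
  have h0 : ∫ t in Icc 0 T, (inner ℝ (x' t - x t) (P.mapQ (x' t - x t)) +
        inner ℝ (u' t - u t) (P.mapR (u' t - u t))) = 0 := by
    rw [integral_Icc_eq_integral_Ioc, ← intervalIntegral.integral_of_le hT.le]
    exact le_antisymm (by linarith) (intervalIntegral.integral_nonneg hT.le fun t _ => hnn t)
  rw [intervalIntegrable_iff_integrableOn_Icc_of_le hT.le] at hqint
  rw [integral_eq_zero_iff_of_nonneg hnn hqint] at h0
  have hz : ∀ᵐ t ∂(volume.restrict (Icc 0 T)), x' t - x t = 0 ∧ u' t - u t = 0 :=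
    h0.mono fun t ht => eq_zero_of_quadratic_le hQ hR (le_of_eq ht)
  exact ⟨Measure.eqOn_Icc_of_ae_eq volume hT.ne (hz.mono fun t ht => sub_eq_zero.1 ht.1)
    h'.1.continuousOn_state h.continuous_state.continuousOn,
    hz.mono fun t ht => sub_eq_zero.1 ht.2⟩

end Extremal

end LQProblem

/-! ### The turnpike theorem. -/

theorem mainTheorem1 {d r : ℕ} (P : LQProblem d r)
    (hQ : P.Q.PosDef) (hR : P.R.PosDef) (hAB : KalmanCondition P.A P.B) :
    -- the static problem has a unique solution, with a unique multiplier
    ∃ (xbar : EuclideanSpace ℝ (Fin d)) (ubar : EuclideanSpace ℝ (Fin r))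
      (pbar : EuclideanSpace ℝ (Fin d)),
      P.IsStaticOptimum xbar ubar ∧
      (∀ x u, P.IsStaticOptimum x u → x = xbar ∧ u = ubar) ∧
      P.IsStaticMultiplier xbar ubar pbar ∧
      (∀ p, P.IsStaticMultiplier xbar ubar p → p = pbar) ∧
      -- the constants do not depend on the horizon `T`
      ∃ ν : ℝ, 0 < ν ∧ ∀ T₀ : ℝ, 0 < T₀ → ∃ C : ℝ, 0 < C ∧ ∀ T : ℝ, T₀ ≤ T →
        -- the dynamic problem has a unique solution (with a continuous control), whose adjoint
        -- vector exists and is unique, and the turnpike estimate holds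
        ∃ (x : ℝ → EuclideanSpace ℝ (Fin d)) (u : ℝ → EuclideanSpace ℝ (Fin r))
          (p : ℝ → EuclideanSpace ℝ (Fin d)),
          P.IsOptimal T x u ∧
          ContinuousOn u (Icc 0 T) ∧
          (∀ x' u', P.IsOptimal T x' u' →
            EqOn x' x (Icc 0 T) ∧ u' =ᵐ[volume.restrict (Icc 0 T)] u) ∧
          P.IsNormalAdjoint T x u p ∧
          (∀ p', P.IsNormalAdjoint T x u p' → EqOn p' p (Icc 0 T)) ∧
          ∀ t ∈ Icc 0 T,
            ‖x t - xbar‖ + ‖u t - ubar‖ + ‖p t - pbar‖ ≤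
              C * (Real.exp (-ν * t) + Real.exp (-ν * (T - t))) := by
  obtain ⟨xbar, ubar, pbar, hdyn, hxbar, hubar⟩ := LQProblem.exists_static_solution hQ hR hAB
  have hubar' := LQProblem.mapR_sub_uhat hR hubar
  obtain ⟨hopt, huniq⟩ := LQProblem.isStaticOptimum_of_stationary hQ hR hdyn hxbar hubar'
  have hmult := (LQProblem.isStaticMultiplier_iff hQ hR pbar).2 ⟨hxbar, hubar'⟩
  refine ⟨xbar, ubar, pbar, hopt, huniq, hmult,
    fun p hp => LQProblem.staticMultiplier_unique hQ hR hAB hmult hp, ?_⟩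
  have hH := LQProblem.hamiltonianHyp hQ hR hAB
  obtain ⟨ν, hν, K₁, hK₁, hdich⟩ := hH.exists_dichotomy
  refine ⟨ν, hν, fun T₀ hT₀ => ?_⟩
  -- `T₀` enters only through `K₂`; `ν` and `K₁` are already fixed.
  obtain ⟨K₂, hK₂, hbdry⟩ := hH.exists_boundary_bound hT₀
  set G := ‖P.feedback‖
  set D := ‖P.x₀ - xbar‖ + ‖P.x₁ - xbar‖
  -- The `+ 1` keeps the constant positive when both end points equal `xbar`, that is `D = 0`.
  refine ⟨(2 + G) * (K₁ * (K₂ * D)) + 1, by positivity, fun T hT => ?_⟩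
  have hTpos : 0 < T := hT₀.trans_le hT
  obtain ⟨z₀, hz₀, hzT⟩ := hH.exists_boundary_solution hTpos (P.x₀ - xbar) (P.x₁ - xbar)
  set z := fun t => linearFlow (hamiltonianMap P.mapA (P.mapB ∘L P.feedback) P.mapQ) t z₀ with hz
  have hext : P.IsExtremal T (fun t => xbar + (z t).1) (fun t => ubar + P.feedback (z t).2)
      (fun t => pbar + (z t).2) := by
    refine ⟨fun t => ?_, fun t => ?_, fun t => ?_, ?_, ?_⟩
    · refine ((hasDerivAt_fst_hamiltonianFlow P.mapA (P.mapB ∘L P.feedback) P.mapQ z₀ t).const_add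
        xbar).congr_deriv ?_
      rw [LQProblem.dynamics_eq] at hdyn ⊢
      rw [map_add, map_add, add_add_add_comm, hdyn, zero_add]; rfl
    · refine ((hasDerivAt_snd_hamiltonianFlow P.mapA (P.mapB ∘L P.feedback) P.mapQ z₀ t).const_add
        pbar).congr_deriv ?_
      rw [show xbar + (z t).1 - P.xhat = xbar - P.xhat + (z t).1 by abel, map_add, map_add, hxbar,
        add_sub_add_left_eq_sub]
    · simp only [map_add]
      rw [hubar, add_assoc]
    · simp [hz, linearFlow_zero, hz₀]
    · simp [hz, hzT]
  refine ⟨_, _, _, hext.isOptimal hQ hR hTpos, hext.continuous_control.continuousOn,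
    fun x' u' h' => hext.unique hQ hR hTpos h', hext.isNormalAdjoint hQ hR,
    fun p' hp' => (hext.isNormalAdjoint hQ hR).eqOn hQ hR hAB hTpos
      hext.continuous_state.continuousOn hp', fun t ht => ?_⟩
  simp only [add_sub_cancel_left]
  have hsum : ‖(z t).1‖ + ‖P.feedback (z t).2‖ + ‖(z t).2‖ ≤ (2 + G) * ‖z t‖ := by
    have h1 := norm_fst_le (z t)
    have h2 := norm_snd_le (z t)
    have h3 : ‖P.feedback (z t).2‖ ≤ G * ‖z t‖ := (P.feedback.le_opNorm _).trans (by gcongr)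
    linarith
  have hb := hbdry z₀ T hT
  rw [hz₀, hzT] at hb
  change ‖z₀‖ + ‖z T‖ ≤ K₂ * D at hb
  have hzt : ‖z t‖ ≤ K₁ * (K₂ * D) * (Real.exp (-ν * t) + Real.exp (-ν * (T - t))) := by
    calc ‖z t‖ ≤ K₁ * (Real.exp (-ν * t) * ‖z₀‖ + Real.exp (-ν * (T - t)) * ‖z T‖) :=
          hdich z₀ T t ht
      _ ≤ K₁ * (Real.exp (-ν * t) * (K₂ * D) + Real.exp (-ν * (T - t)) * (K₂ * D)) := by
          gcongr
          · linarith [norm_nonneg (z T)]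
          · linarith [norm_nonneg z₀]
      _ = _ := by ring
  calc _ ≤ (2 + G) * ‖z t‖ := hsum
    _ ≤ (2 + G) * (K₁ * (K₂ * D) * (Real.exp (-ν * t) + Real.exp (-ν * (T - t)))) := by gcongr
    _ = (2 + G) * (K₁ * (K₂ * D)) * (Real.exp (-ν * t) + Real.exp (-ν * (T - t))) := by ring
    _ ≤ ((2 + G) * (K₁ * (K₂ * D)) + 1) * (Real.exp (-ν * t) + Real.exp (-ν * (T - t))) := by
        gcongr
        linarith
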